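/- **Setting and definitions.** Let $\mathcal C$ be a small category, $\mathcal D$ a locally small category, $\mathcal C\hookrightarrow\mathcal D$ a full embedding (a full and faithful functor) and $u$ an object of $\mathcal D$. * $\mathcal C$ has the *amalgamation property* (AP) if any two arrows of $\mathcal C$ with common domain can be completed to a commutative square; then the *atomic topology* $J_{at}$ on $\mathcal C^{\mathrm{op}}$ is the Grothendieck topology whose covering sieves are exactly the non-empty ones, and $l:\mathcal C^{\mathrm{op}}\to \mathbf{Sh}(\mathcal C^{\mathrm{op}},J_{at})$ denotes the Yoneda embedding followed by the associated sheaf functor. An *atom* of a topos is a non-initial object whose only subobjects are the initial one and itself. $\mathcal C$ is *atomically complete* if it satisfies AP, $J_{at}$ is subcanonical, and every atom of $\mathbf{Sh}(\mathcal C^{\mathrm{op}},J_{at})$ is isomorphic to $l(c)$ for some $c\in\mathcal C$. * $u$ is *$\mathcal C$-universal* if every object of $\mathcal C$ admits an arrow to $u$ in $\mathcal D$; it is *$\mathcal C$-ultrahomogeneous* if for all $j:a\to b$ in $\mathcal C$ and all $\chi_1:a\to u$, $\chi_2:b\to u$ in $\mathcal D$ there is an automorphism $g$ of $u$ with $g\circ\chi_1=\chi_2\circ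 j$. * For an arrow $\chi:c\to u$ with $c\in\mathcal C$ put $\mathcal I_\chi=\{g\in \mathrm{Aut}_{\mathcal D}(u) : g\circ\chi=\chi\}$. The group $\mathrm{Aut}_{\mathcal D}(u)$ carries the topology generated by the left cosets of the subgroups $\mathcal I_\chi$ (if any two of the $\mathcal I_\chi$ contain a third one, this is the group topology in which they form a basis of neighbourhoods of the identity). * For a topological group $G$, $\mathbf{Cont}(G)$ is the topos of continuous left actions of $G$ on discrete sets and equivariant maps. Let $F:\mathcal C^{\mathrm{op}}\to\mathbf{Cont}(\mathrm{Aut}_{\mathcal D}(u))$ be the functor sending $c$ to $\mathrm{Hom}_{\mathcal D}(c,u)$ with the action $g\cdot\chi=g\circ\chi$ (so that $\mathcal I_\chi$ is the stabilizer of $\chi$) and $f:c\to d$ to $-\circ f$. * $\mathcal C/u$ is the category whose objects are the arrows $\chi:c\to u$ of $\mathcal D$ with $c\in\mathcal C$ and whose arrows are the arrows of $\mathcal C$ commuting with the maps to $u$. **Theorem.** Let $\mathcal C$ be atomically complete and $u$ be $\mathcal C$-universal and $\mathcal C$-ultrahomogeneous, and suppose that $F$ induces an equivalence $$\mathbf{Sh}(\mathcal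 C^{\mathrm{op}},J_{at})\simeq\mathbf{Cont}(\mathrm{Aut}_{\mathcal D}(u)),$$ i.e. there is an equivalence $E$ from the left to the right with $E\circ l\cong F$. Then: 1. $\chi\mapsto\mathcal I_\chi$ induces a bijection between the isomorphism classes of objects of $\mathcal C/u$ and the open subgroups of $\mathrm{Aut}_{\mathcal D}(u)$. 2. For every open subgroup $U$, any arrow $\chi_U:c_U\to u$ corresponding to $U$ in this bijection (i.e. with $\mathcal I_{\chi_U}=U$) is fixed by all the automorphisms in $U$, and every arrow $\psi:a\to u$ of $\mathcal D$ with $a\in\mathcal C$ which is fixed by all the automorphisms in $U$ factors through $\chi_U$ by a unique arrow $a\to c_U$. -/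

import Mathlib

open CategoryTheory Opposite

universe w u

namespace GaloisTopos

section Sites

variable (C : Type w) [SmallCategory C]

/-- The amalgamation property: any two arrows with common domain can be completed to a
commutative square. -/
def AmalgamationProperty : Prop :=
  ∀ ⦃a b c : C⦄ (f : a ⟶ b) (g : a ⟶ c), ∃ (d : C) (f' : b ⟶ d) (g' : c ⟶ d), f ≫ f' = g ≫ g'

variable {C}

theorem AmalgamationProperty.rightOreCondition_op (h : AmalgamationProperty C) :
    GrothendieckTopology.RightOreCondition Cᵒᵖ := by
  intro X Y Z yx zx
  obtain ⟨d, f', g', e⟩ := h yx.unop zx.unop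
  exact ⟨op d, f'.op, g'.op, Quiver.Hom.unop_inj e⟩

/-- The atomic topology on `Cᵒᵖ`, whose covering sieves are exactly the nonempty ones. -/
def atomicTopology (h : AmalgamationProperty C) : GrothendieckTopology Cᵒᵖ :=
  GrothendieckTopology.atomic h.rightOreCondition_op

/-- The functor `l : Cᵒᵖ ⥤ Sh(Cᵒᵖ, J_at)`: the Yoneda embedding followed by the associated sheaf
functor. -/
noncomputable def sheafYoneda (h : AmalgamationProperty C) :
    Cᵒᵖ ⥤ Sheaf (atomicTopology h) (Type w) :=
  yoneda ⋙ presheafToSheaf (atomicTopology h) (Type w)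

/-- An atom of a topos: an object which is not initial and whose only subobjects are the initial
one and itself. -/
def IsAtomObject {E : Type*} [Category E] (A : E) : Prop :=
  IsEmpty (Limits.IsInitial A) ∧
    ∀ ⦃B : E⦄ (m : B ⟶ A), Mono m → Nonempty (Limits.IsInitial B) ∨ IsIso m

variable (C) in
/-- Atomically complete categories: `C` satisfies the amalgamation property, the atomic topology
on `Cᵒᵖ` is subcanonical, and every atom of `Sh(Cᵒᵖ, J_at)` is isomorphic to some `l(c)`. -/
structure AtomicallyComplete : Prop where
  amalgamation : AmalgamationProperty C
  subcanonical : (atomicTopology amalgamation).Subcanonical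
  exists_iso_of_isAtomObject : ∀ A : Sheaf (atomicTopology amalgamation) (Type w),
    IsAtomObject A → ∃ c : C, Nonempty (A ≅ (sheafYoneda amalgamation).obj (op c))

end Sites

section ContinuousActions

variable (G : Type w) [Group G] [TopologicalSpace G]

/-- A left `G`-set `X` is continuous if the action map `G × X → X` is continuous, where `X` is
given the discrete topology and `G × X` the product topology. -/
def IsContinuousAction (X : Action (Type w) G) : Prop :=
  letI : TopologicalSpace X.V := ⊥
  Continuous fun p : G × X.V => X.ρ p.1 p.2

/-- The topos `Cont(G)` of continuous actions of `G` on discrete sets and equivariant maps. -/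
abbrev Cont : Type (w + 1) :=
  ObjectProperty.FullSubcategory (fun X : Action (Type w) G => IsContinuousAction G X)

end ContinuousActions

section Automorphisms

variable {C : Type w} [SmallCategory C] {D : Type u} [Category.{w} D]

/-- `u` is `C`-universal: every object of `C` admits an arrow to `u`. -/
def IsUniversal (i : C ⥤ D) (u : D) : Prop :=
  ∀ a : C, Nonempty (i.obj a ⟶ u)

/-- `u` is `C`-ultrahomogeneous. -/
def IsUltrahomogeneous (i : C ⥤ D) (u : D) : Prop :=
  ∀ ⦃a b : C⦄ (j : a ⟶ b) (χ₁ : i.obj a ⟶ u) (χ₂ : i.obj b ⟶ u),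
    ∃ g : u ≅ u, χ₁ ≫ g.hom = i.map j ≫ χ₂

/-- The group `Aut_D(u)`, with multiplication `(g * h).hom = h.hom ≫ g.hom`, that is `g ∘ h`.
The functor `i` is a parameter because the topology below depends on it. -/
@[nolint unusedArguments]
def AutGroup (_i : C ⥤ D) (u : D) : Type w := Aut u

variable (i : C ⥤ D) (u : D)

instance : Group (AutGroup i u) := inferInstanceAs (Group (Aut u))

variable {i u}

/-- The underlying arrow `u ⟶ u` of an automorphism of `u`. -/
def AutGroup.hom (g : AutGroup i u) : u ⟶ u := Iso.hom (X := u) (Y := u) g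

@[simp]
theorem AutGroup.hom_one : (1 : AutGroup i u).hom = 𝟙 u := rfl

@[simp]
theorem AutGroup.hom_mul (g h : AutGroup i u) : (g * h).hom = h.hom ≫ g.hom := rfl

/-- The subgroup `I_χ` of the automorphisms of `u` which fix `χ : c ⟶ u`. -/
def fixingSubgroup {c : C} (χ : i.obj c ⟶ u) : Subgroup (AutGroup i u) where
  carrier := {g | χ ≫ g.hom = χ}
  one_mem' := by simp
  mul_mem' {g h} hg hh := by
    simp only [Set.mem_ofPred_eq] at hg hh ⊢
    rw [AutGroup.hom_mul, ← Category.assoc, hh, hg]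
  inv_mem' {g} hg := by
    simp only [Set.mem_ofPred_eq] at hg ⊢
    have e : g.hom ≫ (g⁻¹).hom = 𝟙 u := by
      rw [← AutGroup.hom_mul, inv_mul_cancel, AutGroup.hom_one]
    calc χ ≫ (g⁻¹).hom = (χ ≫ g.hom) ≫ (g⁻¹).hom := by rw [hg]
      _ = χ := by rw [Category.assoc, e, Category.comp_id]

@[simp]
theorem mem_fixingSubgroup {c : C} (χ : i.obj c ⟶ u) (g : AutGroup i u) :
    g ∈ fixingSubgroup χ ↔ χ ≫ g.hom = χ := Iff.rfl

/-- The topology on `Aut_D(u)` generated by the subgroups `I_χ`: the coarsest topology for which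
all left cosets `g I_χ` are open. The `I_χ` are a basis of neighbourhoods of the identity as soon
as any two of them contain a third one. -/
instance : TopologicalSpace (AutGroup i u) :=
  TopologicalSpace.generateFrom
    {S | ∃ (c : C) (χ : i.obj c ⟶ u) (g : AutGroup i u),
      S = (fun h => g * h) '' (fixingSubgroup χ : Set (AutGroup i u))}

theorem isOpen_coset {c : C} (χ : i.obj c ⟶ u) (g : AutGroup i u) :
    IsOpen ((fun h => g * h) '' (fixingSubgroup χ : Set (AutGroup i u))) :=
  TopologicalSpace.isOpen_generateFrom_of_mem ⟨c, χ, g, rfl⟩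

theorem isOpen_fixingSubgroup {c : C} (χ : i.obj c ⟶ u) :
    IsOpen (fixingSubgroup χ : Set (AutGroup i u)) := by
  simpa using isOpen_coset χ (1 : AutGroup i u)

variable (i u)

/-- The action of `Aut_D(u)` on `Hom_D(c, u)` by composition, `g • χ = g ∘ χ`. -/
instance (c : C) : MulAction (AutGroup i u) (i.obj c ⟶ u) where
  smul g χ := χ ≫ g.hom
  one_smul χ := Category.comp_id χ
  mul_smul g h χ := (Category.assoc χ h.hom g.hom).symm

variable {i u} in
theorem smul_eq_comp {c : C} (g : AutGroup i u) (χ : i.obj c ⟶ u) : g • χ = χ ≫ g.hom := rfl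

theorem isContinuousAction_hom (c : C) :
    IsContinuousAction (AutGroup i u) (Action.ofMulAction (AutGroup i u) (i.obj c ⟶ u)) := by
  let _ : TopologicalSpace (i.obj c ⟶ u) := ⊥
  have _ : DiscreteTopology (i.obj c ⟶ u) := ⟨rfl⟩
  change Continuous fun p : AutGroup i u × (i.obj c ⟶ u) => p.1 • p.2
  refine continuous_def.2 fun s _ => isOpen_iff_forall_mem_open.2 ?_
  rintro ⟨g, χ⟩ hgχ
  refine ⟨((fun h => g * h) '' (fixingSubgroup χ : Set (AutGroup i u))) ×ˢ {χ}, ?_,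
    (isOpen_coset χ g).prod (isOpen_discrete _), ⟨1, one_mem _, mul_one g⟩, rfl⟩
  rintro ⟨k, ψ⟩ ⟨⟨h, hh, hk⟩, hψ⟩
  obtain rfl : ψ = χ := hψ
  obtain rfl : g * h = k := hk
  have e : (g * h) • ψ = g • ψ := by
    rw [mul_smul]
    exact congrArg (g • ·) hh
  change (g * h) • ψ ∈ s
  rw [e]
  exact hgχ

/-- The functor `F : Cᵒᵖ ⥤ Cont(Aut_D(u))` sending `c` to `Hom_D(c, u)` and `f : c ⟶ d` to the
equivariant map `- ∘ f : Hom_D(d, u) → Hom_D(c, u)`. -/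
def homFunctor : Cᵒᵖ ⥤ Cont (AutGroup i u) :=
  ObjectProperty.lift _
    { obj := fun c => Action.ofMulAction (AutGroup i u) (i.obj c.unop ⟶ u)
      map := fun {c d} f =>
        { hom := TypeCat.ofHom fun χ : i.obj c.unop ⟶ u => i.map f.unop ≫ χ
          comm := fun g => ConcreteCategory.hom_ext _ _ fun χ : i.obj c.unop ⟶ u =>
            (Category.assoc (i.map f.unop) χ g.hom).symm }
      map_id := fun c => Action.Hom.ext <| ConcreteCategory.hom_ext _ _
        fun χ : i.obj c.unop ⟶ u =>
          show i.map (𝟙 c.unop) ≫ χ = χ by rw [i.map_id, Category.id_comp]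
      map_comp := fun {a b c} f g => Action.Hom.ext <| ConcreteCategory.hom_ext _ _
        fun χ : i.obj a.unop ⟶ u =>
          show i.map (g.unop ≫ f.unop) ≫ χ = i.map g.unop ≫ i.map f.unop ≫ χ by
            rw [i.map_comp, Category.assoc] }
    (fun c => isContinuousAction_hom i u c.unop)

/-- The condition that `F` induces an equivalence `Sh(Cᵒᵖ, J_at) ≃ Cont(Aut_D(u))`:
there is an equivalence whose composite with `l` is isomorphic to `F`. -/
def InducesEquivalence (h : AmalgamationProperty C) : Prop :=
  ∃ e : Sheaf (atomicTopology h) (Type w) ≌ Cont (AutGroup i u),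
    Nonempty (sheafYoneda h ⋙ e.functor ≅ homFunctor i u)

/-- The open subgroup `I_χ` of `Aut_D(u)` attached to an object `χ : c ⟶ u` of the slice
category `C/u` (arrows of `C/u` are the arrows of `C` commuting with the structure maps). -/
def openFixingSubgroup (x : CostructuredArrow i u) : OpenSubgroup (AutGroup i u) :=
  ⟨fixingSubgroup (i := i) (c := x.left) x.hom, isOpen_fixingSubgroup _⟩

variable {i u} in
theorem fixingSubgroup_le_of_hom {x y : CostructuredArrow i u} (f : x ⟶ y) :
    openFixingSubgroup i u y ≤ openFixingSubgroup i u x := by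
  intro g hg
  have hg' : y.hom ≫ g.hom = y.hom := hg
  change x.hom ≫ g.hom = x.hom
  have e : i.map f.left ≫ y.hom = x.hom := CostructuredArrow.w f
  rw [← e, Category.assoc, hg']

/-- The map induced by `χ ↦ I_χ` from the isomorphism classes of objects of `C/u` to the open
subgroups of `Aut_D(u)`. -/
def galoisMap :
    Quotient (isIsomorphicSetoid (CostructuredArrow i u)) → OpenSubgroup (AutGroup i u) :=
  Quotient.lift (openFixingSubgroup i u) fun _ _ ⟨e⟩ =>
    le_antisymm (fixingSubgroup_le_of_hom e.inv) (fixingSubgroup_le_of_hom e.hom)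

end Automorphisms

end GaloisTopos

namespace GaloisTopos

/-! ### Continuous actions: open transporters, monomorphisms and atoms. -/

section ContinuousActions

variable {G : Type w} [Group G] [TopologicalSpace G]

/-! Write `G` for the automorphism group of `u`. By ultrahomogeneity each `Hom(c, u)` is a
transitive `G`-set, so equivariant maps from it to `Hom(a, u)` correspond, by evaluation at `χ`, to
the `ψ : a ⟶ u` fixed by `I_χ`. Subcanonicity makes `l`, hence `F`, fully faithful, so these maps
are the arrows `a ⟶ c`. Thus `ψ` factors uniquely through `χ` (`exists_map_comp_eq`,
`eq_of_map_comp_eq`), which is part 2 and yields injectivity. For surjectivity, `G ⧸ U` is an atom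
of `Cont(G)`. Atomic completeness, carried across the equivalence, gives `G ⧸ U ≅ Hom(c, u)` for
some `c`, and the image of the trivial coset is an arrow with stabilizer `U`. -/

theorem isContinuousAction_iff [SeparatelyContinuousMul G] (X : Action (Type w) G) :
    IsContinuousAction G X ↔ ∀ x y : X.V, IsOpen {g : G | X.ρ g x = y} := by
  let _ : TopologicalSpace X.V := ⊥
  have _ : DiscreteTopology X.V := ⟨rfl⟩
  change (Continuous fun p : G × X.V => X.ρ p.1 p.2) ↔ _
  constructor
  · intro h x y
    exact (isOpen_discrete {y}).preimage (h.comp (Continuous.prodMk_left x))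
  · intro h
    refine continuous_def.2 fun s _ => isOpen_iff_forall_mem_open.2 ?_
    rintro ⟨g, x⟩ hgx
    -- The action is constant on this neighbourhood of `(g, x)`.
    refine ⟨{k : G | X.ρ k x = X.ρ g x} ×ˢ {x}, ?_, (h x _).prod (isOpen_discrete _), rfl, rfl⟩
    rintro ⟨k, y⟩ ⟨hk, hy⟩
    obtain rfl : y = x := hy
    change X.ρ k y ∈ s
    rw [show X.ρ k y = X.ρ g y from hk]
    exact hgx

namespace Cont

/-- The underlying function of a morphism of continuous actions. -/
def toFun {A B : Cont G} (f : A ⟶ B) (x : A.obj.V) : B.obj.V := f.hom.hom x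

theorem toFun_ρ {A B : Cont G} (f : A ⟶ B) (g : G) (x : A.obj.V) :
    toFun f (A.obj.ρ g x) = B.obj.ρ g (toFun f x) :=
  ConcreteCategory.congr_hom (f.hom.comm g) x

theorem hom_ext {A B : Cont G} {f f' : A ⟶ B} (h : ∀ x, toFun f x = toFun f' x) : f = f' :=
  ObjectProperty.hom_ext _ (Action.Hom.ext (ConcreteCategory.hom_ext _ _ h))

/-- The morphism of continuous actions given by an equivariant function. -/
def homMk {A B : Cont G} (f : A.obj.V → B.obj.V)
    (hf : ∀ g x, f (A.obj.ρ g x) = B.obj.ρ g (f x)) : A ⟶ B :=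
  ObjectProperty.homMk
    { hom := TypeCat.ofHom f
      comm := fun g => ConcreteCategory.hom_ext _ _ fun x => hf g x }

theorem ρ_one (A : Cont G) (x : A.obj.V) : A.obj.ρ 1 x = x := by
  rw [map_one]; rfl

theorem ρ_mul (A : Cont G) (g h : G) (x : A.obj.V) :
    A.obj.ρ (g * h) x = A.obj.ρ g (A.obj.ρ h x) := by
  rw [map_mul]; rfl

theorem isIso_of_bijective {A B : Cont G} (f : A ⟶ B) (hf : Function.Bijective (toFun f)) :
    IsIso f := by
  let q := Equiv.ofBijective _ hf
  have hq : ∀ x, toFun f (q.symm x) = x := q.apply_symm_apply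
  refine ⟨homMk (B := A) q.symm fun g x => hf.1 ?_, hom_ext fun x => q.symm_apply_apply x,
    hom_ext fun x => hq x⟩
  rw [hq, toFun_ρ, hq]

/-- A continuous action without elements is initial. -/
def isInitialOfIsEmpty (A : Cont G) [IsEmpty A.obj.V] : Limits.IsInitial A :=
  Limits.IsInitial.ofUniqueHom (fun _ => homMk isEmptyElim fun _ x => isEmptyElim x)
    fun _ _ => hom_ext fun x => isEmptyElim x

variable [SeparatelyContinuousMul G]

/-- The continuous action attached to a `G`-set whose transporters are open. -/
def of (X : Type w) [MulAction G X] (h : ∀ x y : X, IsOpen {g : G | g • x = y}) : Cont G :=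
  ⟨Action.ofMulAction G X, (isContinuousAction_iff _).2 h⟩

theorem isEmpty_of_isInitial {A : Cont G} (hA : Limits.IsInitial A) : IsEmpty A.obj.V := by
  let _ : MulAction G PEmpty.{w + 1} :=
    { smul := fun _ x => x, one_smul := fun _ => rfl, mul_smul := fun _ _ _ => rfl }
  exact ⟨fun x => PEmpty.elim (toFun (hA.to (of PEmpty fun x => x.elim)) x)⟩

/-- The kernel pair `K` is itself a continuous action, its transporters being intersections of two
transporters of `A`; a monomorphism equalizes its two projections. -/
theorem toFun_injective_of_mono {A B : Cont G} (m : A ⟶ B) [Mono m] :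
    Function.Injective (toFun m) := by
  let K : Type w := {p : A.obj.V × A.obj.V // toFun m p.1 = toFun m p.2}
  let _ : MulAction G K :=
    { smul := fun g p => ⟨(A.obj.ρ g p.1.1, A.obj.ρ g p.1.2), by
        simp only [toFun_ρ, p.2]⟩
      one_smul := fun p => Subtype.ext (Prod.ext (ρ_one A _) (ρ_one A _))
      mul_smul := fun g h p => Subtype.ext (Prod.ext (ρ_mul A g h _) (ρ_mul A g h _)) }
  have hA := (isContinuousAction_iff _).1 A.property
  let P : Cont G := of K fun x y => by
    convert (hA x.1.1 y.1.1).inter (hA x.1.2 y.1.2) using 1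
    ext g
    exact Subtype.ext_iff.trans Prod.ext_iff
  let p₁ : P ⟶ A := homMk (fun p : K => p.1.1) fun _ _ => rfl
  let p₂ : P ⟶ A := homMk (fun p : K => p.1.2) fun _ _ => rfl
  have e : p₁ = p₂ := (cancel_mono m).1 (hom_ext fun p : K => p.2)
  intro x y hxy
  exact congrArg (fun q : P ⟶ A => toFun q (⟨(x, y), hxy⟩ : K)) e

/-- The continuous action of `G` on the cosets of an open subgroup. -/
def quotient (U : OpenSubgroup G) : Cont G :=
  of (G ⧸ U.toSubgroup) fun x y => by
    induction x using QuotientGroup.induction_on with | H a =>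
    induction y using QuotientGroup.induction_on with | H b =>
    -- `g` carries `aU` to `bU` exactly when `b⁻¹ * (g * a) ∈ U`.
    convert U.isOpen.preimage ((continuous_const_mul b⁻¹).comp (continuous_mul_const a)) using 1
    ext g
    exact eq_comm.trans QuotientGroup.eq

theorem isAtomObject_of_transitive {A : Cont G} (a : A.obj.V)
    (ha : ∀ x : A.obj.V, ∃ g : G, A.obj.ρ g a = x) : IsAtomObject A := by
  refine ⟨⟨fun h => (isEmpty_of_isInitial h).false a⟩, fun B m _ => ?_⟩
  rcases isEmpty_or_nonempty B.obj.V with _ | ⟨⟨b⟩⟩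
  · exact Or.inl ⟨isInitialOfIsEmpty B⟩
  · refine Or.inr (isIso_of_bijective m ⟨toFun_injective_of_mono m, fun x => ?_⟩)
    obtain ⟨g, hg⟩ := ha (toFun m b)
    obtain ⟨h, rfl⟩ := ha x
    -- Since `g` carries `a` to the image of `b`, and `h` carries `a` to the target point, `h * g⁻¹`
    -- carries the former to the latter.
    refine ⟨B.obj.ρ (h * g⁻¹) b, ?_⟩
    rw [toFun_ρ, ← hg, ← ρ_mul, inv_mul_cancel_right]

theorem isAtomObject_quotient (U : OpenSubgroup G) : IsAtomObject (quotient U) := by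
  refine isAtomObject_of_transitive (A := quotient U) ((1 : G) : G ⧸ U.toSubgroup) ?_
  exact fun x : G ⧸ U.toSubgroup => MulAction.exists_smul_eq G ((1 : G) : G ⧸ U.toSubgroup) x

end Cont

end ContinuousActions

/-! ### Transport of atoms, and the Yoneda embedding into sheaves. -/

theorem IsAtomObject.of_equivalence {E E' : Type*} [Category E] [Category E'] (e : E ≌ E')
    {A : E} (hA : IsAtomObject (e.functor.obj A)) : IsAtomObject A := by
  refine ⟨⟨fun h => hA.1.false (h.isInitialObj e.functor _)⟩, fun B m _ => ?_⟩
  refine (hA.2 (e.functor.map m) inferInstance).imp (fun ⟨h⟩ => ⟨h.isInitialOfObj e.functor _⟩) ?_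
  exact fun _ => isIso_of_reflects_iso m e.functor

theorem IsAtomObject.of_iso {E : Type*} [Category E] {A B : E} (e : A ≅ B)
    (hA : IsAtomObject A) : IsAtomObject B := by
  refine ⟨⟨fun h => hA.1.false (h.ofIso e.symm)⟩, fun X m _ => ?_⟩
  refine (hA.2 (m ≫ e.inv) inferInstance).imp id fun (h : IsIso (m ≫ e.inv)) => ?_
  exact IsIso.of_isIso_comp_right m e.inv

section Sites

variable {C : Type w} [SmallCategory C]

/-- If the atomic topology is subcanonical, then `l` is isomorphic to the Yoneda embedding into
sheaves. -/
noncomputable def sheafYonedaIso (h : AmalgamationProperty C)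
    [(atomicTopology h).Subcanonical] : sheafYoneda h ≅ (atomicTopology h).yoneda :=
  Functor.isoWhiskerRight (atomicTopology h).yonedaCompSheafToPresheaf.symm _ ≪≫
    Functor.isoWhiskerLeft (atomicTopology h).yoneda
      (sheafificationNatIso (atomicTopology h) (Type w)).symm

end Sites

/-! ### Arrows to `u` and open subgroups. -/

section Automorphisms

variable {C : Type w} [SmallCategory C] {D : Type u} [Category.{w} D] {i : C ⥤ D} {u : D}

theorem mem_fixingSubgroup_comp {c : C} (χ : i.obj c ⟶ u) (k g : AutGroup i u) :
    g ∈ fixingSubgroup (i := i) (c := c) (χ ≫ k.hom) ↔ k⁻¹ * g * k ∈ fixingSubgroup χ := by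
  change g • k • χ = k • χ ↔ (k⁻¹ * g * k) • χ = χ
  rw [mul_smul, mul_smul, inv_smul_eq_iff]

/-- Right translations preserve the generating family because `g I_χ k⁻¹ = g k⁻¹ I_{k ∘ χ}`. -/
instance : SeparatelyContinuousMul (AutGroup i u) where
  continuous_const_mul {k} := continuous_generateFrom_iff.2 <| by
    rintro _ ⟨c, χ, g, rfl⟩
    convert isOpen_coset χ (k⁻¹ * g) using 1
    ext x
    simp only [Set.image_mul_left, Set.mem_preimage]
    simp [mul_assoc]
  continuous_mul_const {k} := continuous_generateFrom_iff.2 <| by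
    rintro _ ⟨c, χ, g, rfl⟩
    convert isOpen_coset (i := i) (c := c) (χ ≫ k.hom) (g * k⁻¹) using 1
    ext x
    simp only [Set.image_mul_left, Set.mem_preimage, SetLike.mem_coe, mem_fixingSubgroup_comp]
    simp [mul_assoc]

theorem IsUltrahomogeneous.exists_smul_eq (hu : IsUltrahomogeneous i u) {c : C}
    (χ ψ : i.obj c ⟶ u) : ∃ g : AutGroup i u, g • χ = ψ := by
  obtain ⟨g, hg⟩ := hu (𝟙 c) χ ψ
  exact ⟨g, hg.trans (by rw [i.map_id, Category.id_comp])⟩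

/-- There is an equivariant map `Hom_D(c, u) → Hom_D(a, u)` sending `χ` to `ψ` if `I_χ`
fixes `ψ`. -/
theorem exists_homFunctor_hom (hu : IsUltrahomogeneous i u) {a c : C} (χ : i.obj c ⟶ u)
    (ψ : i.obj a ⟶ u) (h : ∀ g ∈ fixingSubgroup χ, ψ ≫ g.hom = ψ) :
    ∃ f : (homFunctor i u).obj (op c) ⟶ (homFunctor i u).obj (op a), Cont.toFun f χ = ψ := by
  choose t ht using hu.exists_smul_eq χ
  -- The map will be `ξ ↦ t ξ • ψ`; since `I_χ` fixes `ψ`, it does not depend on the chosen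
  -- automorphism `t ξ` carrying `χ` to `ξ`.
  have key : ∀ g : AutGroup i u, t (g • χ) • ψ = g • ψ := fun g => by
    have e : g⁻¹ * t (g • χ) ∈ fixingSubgroup χ := by
      change (g⁻¹ * t (g • χ)) • χ = χ
      rw [mul_smul, ht, inv_smul_smul]
    have e' : (g⁻¹ * t (g • χ)) • ψ = ψ := h _ e
    rwa [mul_smul, inv_smul_eq_iff] at e'
  refine ⟨Cont.homMk (fun ξ : i.obj c ⟶ u => t ξ • ψ) fun g (ξ : i.obj c ⟶ u) => ?_, ?_⟩
  · change t (g • ξ) • ψ = g • t ξ • ψ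
    simpa only [mul_smul, ht] using key (g * t ξ)
  · change t χ • ψ = ψ
    simpa using key 1

theorem InducesEquivalence.full {h : AmalgamationProperty C}
    [(atomicTopology h).Subcanonical] (he : InducesEquivalence i u h) :
    (homFunctor i u).Full := by
  obtain ⟨e, ⟨α⟩⟩ := he
  have := Functor.Full.of_iso (sheafYonedaIso h).symm
  exact Functor.Full.of_iso α

theorem InducesEquivalence.faithful {h : AmalgamationProperty C}
    [(atomicTopology h).Subcanonical] (he : InducesEquivalence i u h) :
    (homFunctor i u).Faithful := by
  obtain ⟨e, ⟨α⟩⟩ := he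
  have := Functor.Faithful.of_iso (sheafYonedaIso h).symm
  exact Functor.Faithful.of_iso α

/-- By transitivity, an equivariant map out of `Hom(c, u)` is determined by its value at `χ`. -/
theorem eq_of_map_comp_eq [(homFunctor i u).Faithful] (hu : IsUltrahomogeneous i u) {a c : C}
    (χ : i.obj c ⟶ u) {f f' : a ⟶ c} (h : i.map f ≫ χ = i.map f' ≫ χ) : f = f' := by
  refine Quiver.Hom.op_inj ((homFunctor i u).map_injective (Cont.hom_ext ?_))
  intro (ξ : i.obj c ⟶ u)
  obtain ⟨g, rfl⟩ := hu.exists_smul_eq χ ξ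
  change i.map f ≫ χ ≫ g.hom = i.map f' ≫ χ ≫ g.hom
  rw [← Category.assoc, h, Category.assoc]

theorem exists_map_comp_eq [(homFunctor i u).Full] (hu : IsUltrahomogeneous i u) {a c : C}
    (χ : i.obj c ⟶ u) (ψ : i.obj a ⟶ u) (h : ∀ g ∈ fixingSubgroup χ, ψ ≫ g.hom = ψ) :
    ∃ f : a ⟶ c, i.map f ≫ χ = ψ := by
  obtain ⟨m, hm⟩ := exists_homFunctor_hom hu χ ψ h
  obtain ⟨f, rfl⟩ := (homFunctor i u).map_surjective m
  exact ⟨f.unop, hm⟩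

/-- Arrows with equal fixing subgroups factor through each other; uniqueness of factorizations makes
the two factors mutually inverse. -/
theorem galoisMap_injective [(homFunctor i u).Full] [(homFunctor i u).Faithful]
    (hu : IsUltrahomogeneous i u) : Function.Injective (galoisMap i u) := by
  intro p q
  induction p using Quotient.inductionOn with | h x =>
  induction q using Quotient.inductionOn with | h y =>
  intro (hxy : openFixingSubgroup i u x = openFixingSubgroup i u y)
  obtain ⟨f, hf⟩ := exists_map_comp_eq hu (a := x.left) (c := y.left) y.hom x.hom
    fun g hg => show g ∈ openFixingSubgroup i u x from hxy ▸ hg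
  obtain ⟨f', hf'⟩ := exists_map_comp_eq hu (a := y.left) (c := x.left) x.hom y.hom
    fun g hg => show g ∈ openFixingSubgroup i u y from hxy ▸ hg
  have e : f ≫ f' = 𝟙 x.left := eq_of_map_comp_eq hu (c := x.left) x.hom <| by
    rw [i.map_comp, Category.assoc, hf', hf, i.map_id, Category.id_comp]
  have e' : f' ≫ f = 𝟙 y.left := eq_of_map_comp_eq hu (c := y.left) y.hom <| by
    rw [i.map_comp, Category.assoc, hf, hf', i.map_id, Category.id_comp]
  exact Quotient.sound ⟨CostructuredArrow.isoMk ⟨f, f', e, e'⟩ hf⟩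

theorem galoisMap_surjective (hC : AtomicallyComplete C)
    (he : InducesEquivalence i u hC.amalgamation) : Function.Surjective (galoisMap i u) := by
  intro U
  obtain ⟨e, ⟨α⟩⟩ := he
  let Q := Cont.quotient U
  have hQ : IsAtomObject (e.inverse.obj Q) := .of_equivalence e <|
    (Cont.isAtomObject_quotient U).of_iso (e.counitIso.app Q).symm
  obtain ⟨c, ⟨β⟩⟩ := hC.exists_iso_of_isAtomObject _ hQ
  let γ : Q ≅ (homFunctor i u).obj (op c) :=
    (e.counitIso.app Q).symm ≪≫ e.functor.mapIso β ≪≫ α.app (op c)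
  have hγ : Function.Injective (Cont.toFun γ.hom) := Cont.toFun_injective_of_mono γ.hom
  let b : Q.obj.V := ((1 : AutGroup i u) : AutGroup i u ⧸ U.toSubgroup)
  let χ : i.obj c ⟶ u := Cont.toFun γ.hom b
  refine ⟨Quotient.mk _ (CostructuredArrow.mk χ), ?_⟩
  change openFixingSubgroup i u (CostructuredArrow.mk χ) = U
  ext g
  have h₁ : Cont.toFun γ.hom (Q.obj.ρ g b) = χ ≫ g.hom := Cont.toFun_ρ γ.hom g b
  have h₂ : g ∈ MulAction.stabilizer (AutGroup i u)
      ((1 : AutGroup i u) : AutGroup i u ⧸ U.toSubgroup) ↔ g ∈ U := by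
    rw [MulAction.stabilizer_quotient]; rfl
  change χ ≫ g.hom = χ ↔ g ∈ U
  rw [← h₁, ← h₂]
  -- An injective equivariant map preserves stabilizers.
  exact hγ.eq_iff

end Automorphisms

end GaloisTopos

theorem theorem4p15 {C : Type w} [SmallCategory C] {D : Type u} [Category.{w} D]
    (i : C ⥤ D) [i.Full] [i.Faithful] (u : D)
    (hC : GaloisTopos.AtomicallyComplete C)
    (huniv : GaloisTopos.IsUniversal i u)
    (hultra : GaloisTopos.IsUltrahomogeneous i u)
    (hequiv : GaloisTopos.InducesEquivalence i u hC.amalgamation) :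
    Function.Bijective (GaloisTopos.galoisMap i u) ∧
    ∀ (U : OpenSubgroup (GaloisTopos.AutGroup i u)) (x : CostructuredArrow i u),
      GaloisTopos.openFixingSubgroup i u x = U →
        (∀ g ∈ U, x.hom ≫ g.hom = x.hom) ∧
        ∀ (a : C) (ψ : i.obj a ⟶ u), (∀ g ∈ U, ψ ≫ g.hom = ψ) →
          ∃! f : i.obj a ⟶ i.obj x.left, f ≫ x.hom = ψ := by
  have := hC.subcanonical
  have := hequiv.full
  have := hequiv.faithful
  refine ⟨⟨GaloisTopos.galoisMap_injective hultra,
    GaloisTopos.galoisMap_surjective hC hequiv⟩, ?_⟩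
  rintro _ x rfl
  refine ⟨fun _ hg => hg, fun a ψ hψ => ?_⟩
  obtain ⟨f, hf⟩ := GaloisTopos.exists_map_comp_eq hultra (c := x.left) x.hom ψ hψ
  refine ⟨i.map f, hf, fun f' hf' => ?_⟩
  -- Uniqueness is asked among arrows of `D`; fullness of `i` brings the competitor back to `C`.
  obtain ⟨f', rfl⟩ := i.map_surjective f'
  exact congrArg i.map (GaloisTopos.eq_of_map_comp_eq hultra (c := x.left) x.hom (hf'.trans hf.symm))
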